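/- Let $k$ be a field and let $H$ be a Hopf algebra over $k$ with bijective antipode, with comultiplication $\Delta$ and counit $\varepsilon$. Let $B$ be a right $H$-comodule algebra, i.e. a $k$-algebra with a coassociative and counital coaction $\rho : B \to B\otimes_k H$ that is a homomorphism of algebras, and suppose that $B$ is an $H$-Galois extension of $k$: the unit map $k \to B$ is injective with image the coinvariants $B^{\mathrm{co} H} = \{ b\in B : \rho(b) = b\otimes 1\}$ (in particular $B\neq 0$), and the canonical map $B\otimes_k B \to B\otimes_k H$, $b'\otimes b \mapsto (b'\otimes 1)\rho(b)$, is bijective. For a ring $R$ and $0\le n\le\infty$, a left $R$-module $M$ is said to be of type $\mathbf{FP}_n$ if there is a projective resolution $\cdots\to P_1\to P_0\to M\to 0$ over $R$ in which $P_i$ is finitely generated for every integer $i$ with $0\le i\le n$ (for every $i\ge 0$ when $n=\infty$). The Hopf algebra $H$ is said to be of type $\mathbf{FP}_n$ if the trivial left $H$-module $k$, on which $h\in H$ acts as multiplication by $\varepsilon(h)$, is of type $\mathbf{FP}_n$. Let $B^e = B\otimes_k B^{op}$, acting on $B$ on the left by $(a\otimes b)\cdot x = axb$. Then, for every $0\le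 n\le\infty$, $H$ is of type $\mathbf{FP}_n$ if and only if $B$ is of type $\mathbf{FP}_n$ as a left $B^e$-module. -/

import Mathlib

open scoped TensorProduct

universe u v w

/-- A projective resolution `⋯ → P 2 → P 1 → P 0 → M → 0` of a left `R`-module `M`. -/
structure ProjRes (R : Type u) [Ring R] (M : Type v) [AddCommGroup M] [Module R M] where
  P : ℕ → Type (max u v)
  [addCommGroup : ∀ i, AddCommGroup (P i)]
  [module : ∀ i, Module R (P i)]
  projective : ∀ i, Module.Projective R (P i)
  d : ∀ i, P (i + 1) →ₗ[R] P i
  aug : P 0 →ₗ[R] M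
  aug_surjective : Function.Surjective aug
  exact_zero : Function.Exact (d 0) aug
  exact_succ : ∀ i, Function.Exact (d (i + 1)) (d i)

attribute [instance] ProjRes.addCommGroup ProjRes.module

/-- `M` is of type `FP_n`, where `n` is a natural number or `∞` (written `⊤`): some projective
resolution of `M` has finitely generated terms in all degrees `i ≤ n`. -/
def IsTypeFP (n : ℕ∞) (R : Type u) [Ring R] (M : Type v) [AddCommGroup M] [Module R M] : Prop :=
  ∃ C : ProjRes R M, ∀ i : ℕ, (i : ℕ∞) ≤ n → Module.Finite R (C.P i)

/-- The base field `k`, regarded as the trivial left module of a bialgebra `H`. -/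
def TrivialModule (k : Type u) (_H : Type v) : Type u := k

section Trivial

variable (k : Type u) (H : Type v) [Field k] [Ring H] [Bialgebra k H]

instance : AddCommGroup (TrivialModule k H) := inferInstanceAs (AddCommGroup k)

/-- `H` acts on `k` through the counit: `h • x = ε(h) x`. -/
instance : Module H (TrivialModule k H) :=
  Module.compHom k (Bialgebra.counitAlgHom k H).toRingHom

theorem TrivialModule.smul_def (h : H) (x : k) :
    (h • (show TrivialModule k H from x) : TrivialModule k H) =
      (Coalgebra.counit (R := k) h * x : k) := rfl

end Trivial

/-- The Hopf algebra `H` is of type `FP_n` if its trivial left module `k` is. -/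
def HopfAlgebra.IsTypeFP (n : ℕ∞) (k : Type u) (H : Type v) [Field k] [Ring H]
    [HopfAlgebra k H] : Prop :=
  _root_.IsTypeFP n H (TrivialModule k H)

/-- The algebra `B` is of type `FP_n` as a left module over its enveloping algebra
`Bᵉ = B ⊗ Bᵒᵖ`, which acts by `(a ⊗ b) • x = a x b`. -/
def IsBimoduleTypeFP (n : ℕ∞) (k : Type u) (B : Type v) [Field k] [Ring B] [Algebra k B] : Prop :=
  letI : Module (B ⊗[k] Bᵐᵒᵖ) B := TensorProduct.Algebra.module
  _root_.IsTypeFP n (B ⊗[k] Bᵐᵒᵖ) B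

/-- A right `H`-comodule algebra structure on the algebra `B`: a coassociative and counital
coaction `ρ : B → B ⊗ H` that is a homomorphism of algebras. -/
structure RightComoduleAlgebra (k : Type u) (H : Type v) (B : Type w) [Field k] [Ring H]
    [Bialgebra k H] [Ring B] [Algebra k B] where
  ρ : B →ₐ[k] B ⊗[k] H
  /-- `(id ⊗ Δ) ∘ ρ = (ρ ⊗ id) ∘ ρ` -/
  coassoc : (Coalgebra.comul (R := k) (A := H)).lTensor B ∘ₗ ρ.toLinearMap =
    (TensorProduct.assoc k B H H).toLinearMap ∘ₗ ρ.toLinearMap.rTensor H ∘ₗ ρ.toLinearMap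
  /-- `(id ⊗ ε) ∘ ρ = id` -/
  counit : (TensorProduct.rid k B).toLinearMap ∘ₗ
    (Coalgebra.counit (R := k) (A := H)).lTensor B ∘ₗ ρ.toLinearMap = LinearMap.id

namespace RightComoduleAlgebra

variable {k : Type u} {H : Type v} {B : Type w} [Field k] [Ring H] [Bialgebra k H] [Ring B]
  [Algebra k B]

/-- The coinvariants `{b ∈ B | ρ(b) = b ⊗ 1}`. -/
def coinvariants (c : RightComoduleAlgebra k H B) : Subalgebra k B :=
  AlgHom.equalizer c.ρ Algebra.TensorProduct.includeLeft

theorem mem_coinvariants (c : RightComoduleAlgebra k H B) (b : B) :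
    b ∈ c.coinvariants ↔ c.ρ b = b ⊗ₜ[k] (1 : H) := Iff.rfl

/-- The canonical map `B ⊗ B → B ⊗ H`, `b' ⊗ b ↦ b' ρ(b)`. -/
noncomputable def canonicalMap (c : RightComoduleAlgebra k H B) : B ⊗[k] B →ₗ[k] B ⊗[k] H :=
  TensorProduct.lift ((LinearMap.mul k (B ⊗[k] H)).compl₁₂
    (Algebra.TensorProduct.includeLeft : B →ₐ[k] B ⊗[k] H).toLinearMap c.ρ.toLinearMap)

theorem canonicalMap_tmul (c : RightComoduleAlgebra k H B) (b' b : B) :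
    c.canonicalMap (b' ⊗ₜ[k] b) = (b' ⊗ₜ[k] (1 : H)) * c.ρ b := rfl

/-- `B` is an `H`-Galois extension of `k`: the unit map identifies `k` with the coinvariants (so
in particular `B ≠ 0`), and the canonical map is bijective. -/
structure IsGaloisOverBase (c : RightComoduleAlgebra k H B) : Prop where
  coinvariants_eq : Function.Bijective (algebraMap k c.coinvariants)
  canonicalMap_bijective : Function.Bijective c.canonicalMap

end RightComoduleAlgebra

-- The functor `M ↦ B ⊗ M` from left `H`-modules to `Bᵉ`-modules, with `b' (b ⊗ m) b'' = b' b b''₀ ⊗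
-- S(b''₁) m`, transports finiteness properties in both directions. It is exact, since `k` is a
-- field, and it sends the trivial module to `B`, because `ε ∘ S = ε` and `ρ` is counital. It sends
-- `H` to a free module of rank one: the orbit map of `1 ⊗ 1` is `b ⊗ b' ↦ b b'₀ ⊗ S(b'₁)`, that is,
-- the canonical map followed by `id ⊗ S`, both bijective. Hence it preserves projectivity and
-- finite generation (`projective_induced`, `finite_induced`). It also reflects finite generation,
-- because `B ≠ 0` is faithfully flat over `k` (`finite_of_finite_induced`).
--
-- Type `FP_n` is recast as an inductive condition on syzygies, `HasFPUpTo`. By Schanuel's lemma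
-- this condition can be tested on any finitely generated projective cover. In particular, descent
-- from `B ⊗ M` to `M` can use covers induced from `H`, so no resolution over `Bᵉ` has to be
-- descended.

universe t t'

open MulOpposite

/-! ### Partial resolutions by finitely generated projectives, and Schanuel's lemma. -/

section FinitePartialResolutions

variable {R : Type u} [Ring R]

/-- `M` is finitely generated, admits a finitely generated projective cover with finitely generated
kernel, and so on, `n` times. -/
def HasFPUpTo (R : Type u) [Ring R] :
    ℕ → ∀ (M : Type t) [AddCommGroup M] [Module R M], Prop
  | 0, M, _, _ => Module.Finite R M
  | n + 1, M, _, _ => ∃ (Q : Type t) (_ : AddCommGroup Q) (_ : Module R Q) (f : Q →ₗ[R] M),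
      Module.Projective R Q ∧ Module.Finite R Q ∧ Function.Surjective f ∧
        HasFPUpTo R n (LinearMap.ker f)

theorem LinearMap.exists_equiv_ker_prod {K P : Type*} [AddCommGroup K] [Module R K]
    [AddCommGroup P] [Module R P] [Module.Projective R P] (g : K →ₗ[R] P)
    (hg : Function.Surjective g) : Nonempty (K ≃ₗ[R] LinearMap.ker g × P) := by
  obtain ⟨s, hs⟩ := Module.projective_lifting_property g LinearMap.id hg
  have hs' : ∀ x, g (s x) = x := fun x => LinearMap.congr_fun hs x
  exact ⟨LinearEquiv.ofBijective
    (LinearMap.prod (LinearMap.codRestrict (LinearMap.ker g) (LinearMap.id - s ∘ₗ g)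
      (fun x => by simp [hs'])) g)
    ⟨by
      rw [injective_iff_map_eq_zero]
      intro x hx
      have h1 : g x = 0 := congrArg Prod.snd hx
      have h2 : x - s (g x) = 0 := congrArg Subtype.val (congrArg Prod.fst hx)
      simpa [h1] using h2,
    by
      rintro ⟨⟨y, hy⟩, p⟩
      have hy' : g y = 0 := hy
      refine ⟨y + s p, ?_⟩
      ext <;> simp [hs', hy']⟩⟩

/-- The kernel of the restriction of `g` to the kernel of `f` is the intersection of kernels. -/
theorem LinearMap.ker_domRestrict_equiv {K P L : Type*} [AddCommGroup K] [Module R K]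
    [AddCommGroup P] [Module R P] [AddCommGroup L] [Module R L] (f : K →ₗ[R] L) (g : K →ₗ[R] P) :
    Nonempty (LinearMap.ker (g.domRestrict (LinearMap.ker f)) ≃ₗ[R]
      (LinearMap.ker f ⊓ LinearMap.ker g : Submodule R K)) :=
  ⟨{ toFun := fun x => ⟨x.1.1, x.1.2, x.2⟩
     invFun := fun x => ⟨⟨x.1, x.2.1⟩, x.2.2⟩
     map_add' := fun _ _ => rfl
     map_smul' := fun _ _ => rfl
     left_inv := fun _ => rfl
     right_inv := fun _ => rfl }⟩

namespace HasFPUpTo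

theorem congr {n : ℕ} {M M' : Type t} [AddCommGroup M] [Module R M] [AddCommGroup M']
    [Module R M'] (e : M ≃ₗ[R] M') (h : HasFPUpTo R n M) : HasFPUpTo R n M' := by
  cases n with
  | zero =>
    have : Module.Finite R M := h
    exact Module.Finite.equiv e
  | succ n =>
    obtain ⟨Q, _, _, f, hP, hF, hs, hk⟩ := h
    refine ⟨Q, _, _, e.toLinearMap ∘ₗ f, hP, hF, e.surjective.comp hs, ?_⟩
    rwa [LinearEquiv.ker_comp]

theorem finite {n : ℕ} {M : Type t} [AddCommGroup M] [Module R M] (h : HasFPUpTo R n M) :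
    Module.Finite R M := by
  cases n with
  | zero => exact h
  | succ n =>
    obtain ⟨Q, _, _, f, hP, hF, hs, hk⟩ := h
    exact Module.Finite.of_surjective f hs

/-- Adding `P` to the first cover by the identity leaves its kernel unchanged. -/
theorem prod {n : ℕ} {M P : Type t} [AddCommGroup M] [Module R M] [AddCommGroup P]
    [Module R P] [Module.Projective R P] [Module.Finite R P] (h : HasFPUpTo R n M) :
    HasFPUpTo R n (M × P) := by
  cases n with
  | zero =>
    have : Module.Finite R M := h
    exact (inferInstance : Module.Finite R (M × P))
  | succ n =>
    obtain ⟨Q, _, _, f, hP, hF, hs, hk⟩ := h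
    refine ⟨Q × P, _, _, f.prodMap LinearMap.id, inferInstance, inferInstance,
      Function.Surjective.prodMap hs Function.surjective_id, hk.congr ?_⟩
    exact
      { toFun := fun x => ⟨(x.1, 0), by simp⟩
        invFun := fun x => ⟨x.1.1, congrArg Prod.fst x.2⟩
        map_add' := fun _ _ => by ext <;> simp
        map_smul' := fun _ _ => by ext <;> simp
        left_inv := fun _ => rfl
        right_inv := fun x => by
          have h : x.1.2 = 0 := congrArg Prod.snd x.2
          ext
          · rfl
          · exact h.symm }

/-- A cover `f` of `M × P` followed by the projection covers `M`. The new kernel maps onto `P` with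
kernel `ker f`, so it splits as `ker f × P`, and `prod` applies. -/
theorem of_prod {n : ℕ} {M P : Type t} [AddCommGroup M] [Module R M] [AddCommGroup P]
    [Module R P] [Module.Projective R P] [Module.Finite R P] (h : HasFPUpTo R n (M × P)) :
    HasFPUpTo R n M := by
  cases n with
  | zero =>
    have : Module.Finite R (M × P) := h
    exact Module.Finite.of_surjective (LinearMap.fst R M P) Prod.fst_surjective
  | succ n =>
    obtain ⟨Q, _, _, f, hP, hF, hs, hk⟩ := h
    refine ⟨Q, _, _, LinearMap.fst R M P ∘ₗ f, hP, hF, Prod.fst_surjective.comp hs, ?_⟩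
    set g := (LinearMap.snd R M P ∘ₗ f).domRestrict (LinearMap.ker (LinearMap.fst R M P ∘ₗ f))
      with hg
    have hgs : Function.Surjective g := by
      intro p
      obtain ⟨q, hq⟩ := hs (0, p)
      exact ⟨⟨q, by simp [hq]⟩, by simp [hg, hq]⟩
    obtain ⟨e⟩ := g.exists_equiv_ker_prod hgs
    obtain ⟨e'⟩ := LinearMap.ker_domRestrict_equiv (LinearMap.fst R M P ∘ₗ f)
      (LinearMap.snd R M P ∘ₗ f)
    have hinf : LinearMap.ker f =
        LinearMap.ker (LinearMap.fst R M P ∘ₗ f) ⊓ LinearMap.ker (LinearMap.snd R M P ∘ₗ f) := by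
      ext x
      simp [Prod.ext_iff]
    exact ((hk.congr ((LinearEquiv.ofEq _ _ hinf).trans e'.symm)).prod (P := P)).congr e.symm

/-- Schanuel's lemma. -/
theorem _root_.LinearMap.schanuel {M Q Q' : Type*} [AddCommGroup M] [Module R M]
    [AddCommGroup Q] [Module R Q] [Module.Projective R Q] [AddCommGroup Q'] [Module R Q']
    [Module.Projective R Q'] (f : Q →ₗ[R] M) (f' : Q' →ₗ[R] M) (hf : Function.Surjective f)
    (hf' : Function.Surjective f') :
    Nonempty ((LinearMap.ker f × Q') ≃ₗ[R] (LinearMap.ker f' × Q)) := by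
  -- The kernel of `D` is the fibre product of `f` and `f'`. Its projections to `Q` and `Q'` are
  -- split surjections with kernels `ker f'` and `ker f`.
  let D : Q × Q' →ₗ[R] M := f.coprod (-f')
  let p := (LinearMap.fst R Q Q').domRestrict (LinearMap.ker D)
  let p' := (LinearMap.snd R Q Q').domRestrict (LinearMap.ker D)
  have hp : Function.Surjective p := fun q => by
    obtain ⟨q', hq'⟩ := hf' (f q)
    exact ⟨⟨(q, q'), by simp [D, hq']⟩, rfl⟩
  have hp' : Function.Surjective p' := fun q' => by
    obtain ⟨q, hq⟩ := hf (f' q')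
    exact ⟨⟨(q, q'), by simp [D, hq]⟩, rfl⟩
  obtain ⟨e⟩ := p.exists_equiv_ker_prod hp
  obtain ⟨e'⟩ := p'.exists_equiv_ker_prod hp'
  have a : LinearMap.ker p ≃ₗ[R] LinearMap.ker f' :=
    { toFun := fun x => ⟨x.1.1.2, by
        have h1 : x.1.1.1 = 0 := x.2
        have h2 : f x.1.1.1 + -f' x.1.1.2 = 0 := x.1.2
        simpa [h1] using h2⟩
      invFun := fun y => ⟨⟨(0, y.1), by simp [D]⟩, rfl⟩
      map_add' := fun _ _ => rfl
      map_smul' := fun _ _ => rfl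
      left_inv := fun x => by
        have h1 : x.1.1.1 = 0 := x.2
        ext
        · exact h1.symm
        · rfl
      right_inv := fun _ => rfl }
  have a' : LinearMap.ker p' ≃ₗ[R] LinearMap.ker f :=
    { toFun := fun x => ⟨x.1.1.1, by
        have h1 : x.1.1.2 = 0 := x.2
        have h2 : f x.1.1.1 + -f' x.1.1.2 = 0 := x.1.2
        simpa [h1] using h2⟩
      invFun := fun y => ⟨⟨(y.1, 0), by simp [D]⟩, rfl⟩
      map_add' := fun _ _ => rfl
      map_smul' := fun _ _ => rfl
      left_inv := fun x => by
        have h1 : x.1.1.2 = 0 := x.2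
        ext
        · rfl
        · exact h1.symm
      right_inv := fun _ => rfl }
  exact ⟨(a'.symm.prodCongr (LinearEquiv.refl R Q')).trans
    (e'.symm.trans (e.trans (a.prodCongr (LinearEquiv.refl R Q))))⟩

/-- This frees `HasFPUpTo` from the cover supplied by its definition: every finitely generated
projective cover serves equally well. -/
theorem ker {n : ℕ} {M Q : Type t} [AddCommGroup M] [Module R M] [AddCommGroup Q]
    [Module R Q] [Module.Projective R Q] [Module.Finite R Q] (h : HasFPUpTo R (n + 1) M)
    (f : Q →ₗ[R] M) (hf : Function.Surjective f) : HasFPUpTo R n (LinearMap.ker f) := by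
  obtain ⟨Q', _, _, f', hP, hF, hs, hk⟩ := h
  obtain ⟨e⟩ := LinearMap.schanuel f' f hs hf
  exact ((hk.prod (P := Q)).congr e).of_prod

theorem exists_finite_cover (R : Type u) [Ring R] (M : Type (max u t)) [AddCommGroup M]
    [Module R M] [Module.Finite R M] :
    ∃ (Q : Type (max u t)) (_ : AddCommGroup Q) (_ : Module R Q) (f : Q →ₗ[R] M),
      Module.Projective R Q ∧ Module.Finite R Q ∧ Function.Surjective f := by
  obtain ⟨m, f, hf⟩ := Module.Finite.exists_fin' R M
  exact ⟨ULift.{max u t} (Fin m → R), inferInstance, inferInstance,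
    f ∘ₗ ULift.moduleEquiv.toLinearMap, Module.Projective.of_equiv ULift.moduleEquiv.symm,
    inferInstance, hf.comp ULift.moduleEquiv.surjective⟩

/-- Independence of the universe in which the covers are taken. -/
theorem congr_universe {n : ℕ} : ∀ {M : Type (max u t)} {M' : Type (max u t')} [AddCommGroup M]
    [Module R M] [AddCommGroup M'] [Module R M'] (_ : M ≃ₗ[R] M'),
    HasFPUpTo R n M → HasFPUpTo R n M' := by
  induction n with
  | zero =>
    intro M M' _ _ _ _ e h
    have : Module.Finite R M := h
    exact Module.Finite.equiv e
  | succ n ih =>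
    intro M M' _ _ _ _ e h
    have := h.finite
    obtain ⟨m, f, hf⟩ := Module.Finite.exists_fin' R M
    let F : ULift.{max u t} (Fin m → R) →ₗ[R] M := f ∘ₗ ULift.moduleEquiv.toLinearMap
    let F' : ULift.{max u t'} (Fin m → R) →ₗ[R] M' :=
      e.toLinearMap ∘ₗ f ∘ₗ ULift.moduleEquiv.toLinearMap
    have : Module.Projective R (ULift.{max u t} (Fin m → R)) :=
      Module.Projective.of_equiv ULift.moduleEquiv.symm
    refine ⟨ULift.{max u t'} (Fin m → R), _, _, F',
      Module.Projective.of_equiv ULift.moduleEquiv.symm, inferInstance,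
      e.surjective.comp (hf.comp ULift.moduleEquiv.surjective), ?_⟩
    have hk := h.ker F (hf.comp ULift.moduleEquiv.surjective)
    -- Both kernels are lifts of `ker f`, to different universes.
    refine ih ?_ hk
    exact
      { toFun := fun x => ⟨ULift.up x.1.down, by
          have h : f x.1.down = 0 := x.2
          simp [F', h]⟩
        invFun := fun x => ⟨ULift.up x.1.down, by
          have h : e (f x.1.down) = 0 := x.2
          simpa [F] using h⟩
        map_add' := fun _ _ => rfl
        map_smul' := fun _ _ => rfl
        left_inv := fun _ => rfl
        right_inv := fun _ => rfl }

end HasFPUpTo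

end FinitePartialResolutions

/-! ### Type `FP_n` in terms of iterated syzygies. -/

section Comparison

variable {R : Type u} [Ring R]

/-- A surjection from a projective module, as one step of a projective resolution. -/
structure ProjCover (R : Type u) [Ring R] (M : ModuleCat.{t} R) where
  Q : ModuleCat.{t} R
  f : Q →ₗ[R] M
  projective : Module.Projective R Q
  surjective : Function.Surjective f

/-- Choosing a cover of each successive kernel, subject to an invariant `Inv`, gives a projective
resolution. -/
theorem IsTypeFP.of_invariant (n : ℕ∞) (Inv : ℕ → ModuleCat.{max u v} R → Prop)
    (step : ∀ i N, Inv i N → ∃ C : ProjCover R N, ((i : ℕ∞) ≤ n → Module.Finite R C.Q) ∧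
      Inv (i + 1) (ModuleCat.of R (LinearMap.ker C.f)))
    (M : Type v) [AddCommGroup M] [Module R M]
    (hM : Inv 0 (ModuleCat.of R (ULift.{u} M))) : IsTypeFP n R M := by
  choose C hfin hnext using step
  let up : ULift.{u} M ≃ₗ[R] M := ULift.moduleEquiv
  let Z : ∀ i, {N : ModuleCat.{max u v} R // Inv i N} := fun i =>
    Nat.rec ⟨_, hM⟩ (fun i N => ⟨ModuleCat.of R (LinearMap.ker (C i N.1 N.2).f), hnext i _ _⟩) i
  let c : ∀ i, ProjCover R (Z i).1 := fun i => C i (Z i).1 (Z i).2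
  let incl : ∀ i, (Z (i + 1)).1 →ₗ[R] (c i).Q := fun i => (LinearMap.ker (c i).f).subtype
  have incl_inj : ∀ i, Function.Injective (incl i) := fun i => Subtype.val_injective
  have incl_ex : ∀ i, Function.Exact (incl i) (c i).f := fun i =>
    LinearMap.exact_subtype_ker_map _
  refine ⟨{
    P := fun i => (c i).Q
    projective := fun i => (c i).projective
    d := fun i => incl i ∘ₗ (c (i + 1)).f
    aug := up.toLinearMap ∘ₗ (c 0).f
    aug_surjective := up.surjective.comp (c 0).surjective
    exact_zero := ?_
    exact_succ := fun i => ?_ }, fun i hi => hfin i _ _ hi⟩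
  · intro x
    constructor
    · intro h
      have h0 : (c 0).f x = 0 := up.injective (h.trans (map_zero _).symm)
      obtain ⟨y, rfl⟩ := (incl_ex 0 x).1 h0
      obtain ⟨z, rfl⟩ := (c 1).surjective y
      exact ⟨z, rfl⟩
    · rintro ⟨z, rfl⟩
      have h0 : (c 0).f (incl 0 ((c 1).f z)) = 0 := (incl_ex 0 _).2 ⟨_, rfl⟩
      change up ((c 0).f (incl 0 ((c 1).f z))) = 0
      rw [h0, map_zero]
  · intro x
    constructor
    · intro h
      have h0 : (c (i + 1)).f x = 0 := incl_inj i (h.trans (map_zero _).symm)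
      obtain ⟨y, rfl⟩ := (incl_ex (i + 1) x).1 h0
      obtain ⟨z, rfl⟩ := (c (i + 2)).surjective y
      exact ⟨z, rfl⟩
    · rintro ⟨z, rfl⟩
      have h0 : (c (i + 1)).f (incl (i + 1) ((c (i + 2)).f z)) = 0 := (incl_ex (i + 1) _).2 ⟨_, rfl⟩
      change incl i ((c (i + 1)).f (incl (i + 1) ((c (i + 2)).f z))) = 0
      rw [h0, map_zero]

theorem IsTypeFP.of_hasFPUpTo {n : ℕ∞} {M : Type v} [AddCommGroup M] [Module R M]
    (h : ∀ i : ℕ, (i : ℕ∞) ≤ n → HasFPUpTo R i (ULift.{u} M)) : IsTypeFP n R M := by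
  refine IsTypeFP.of_invariant n
    -- The `j`-th syzygy keeps the finiteness left over after `j` steps. Quantifying over all `i`
    -- treats finite and infinite `n` alike.
    (fun j N => ∀ i : ℕ, ((i + j : ℕ) : ℕ∞) ≤ n → HasFPUpTo R i N) ?_ M (by simpa using h)
  intro j N hN
  by_cases hj : (j : ℕ∞) ≤ n
  · have : Module.Finite R N := (hN 0 (by simpa using hj)).finite
    obtain ⟨Q, _, _, f, hP, hF, hs⟩ := HasFPUpTo.exists_finite_cover.{u, v} R N
    refine ⟨⟨ModuleCat.of R Q, f, hP, hs⟩, fun _ => hF, fun i hi => ?_⟩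
    exact (hN (i + 1) (by convert hi using 2; omega)).ker f hs
  -- Beyond degree `n` any free cover will do, and the invariant is vacuous.
  · refine ⟨⟨ModuleCat.of R (N →₀ R), Finsupp.linearCombination R id,
      inferInstanceAs (Module.Projective R (N →₀ R)),
      Finsupp.linearCombination_id_surjective R N⟩, fun h => absurd h hj, fun i hi => ?_⟩
    refine absurd (le_trans ?_ hi) hj
    exact_mod_cast (by omega : j ≤ i + (j + 1))

/-- `ker (d j)` is a quotient of `P (j + 2)` with kernel `ker (d (j + 1))`, which accounts for the
bound `i + j + 2`. -/
theorem ProjRes.hasFPUpTo_ker_d {M : Type v} [AddCommGroup M] [Module R M] (C : ProjRes R M) :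
    ∀ i j : ℕ, (∀ l, l ≤ i + j + 2 → Module.Finite R (C.P l)) →
      HasFPUpTo R i (LinearMap.ker (C.d j)) := by
  intro i
  induction i with
  | zero =>
    intro j h
    have := h (j + 2) (by omega)
    rw [← ((C.exact_succ j).linearMap_ker_eq).symm]
    exact Module.Finite.range (C.d (j + 1))
  | succ i ih =>
    intro j h
    let f := (C.d (j + 1)).codRestrict (LinearMap.ker (C.d j))
      (fun x => (C.exact_succ j _).2 ⟨x, rfl⟩)
    refine ⟨C.P (j + 2), _, _, f, C.projective _, h _ (by omega), ?_, ?_⟩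
    · rintro ⟨x, hx⟩
      obtain ⟨y, rfl⟩ := (C.exact_succ j x).1 hx
      exact ⟨y, rfl⟩
    · rw [show LinearMap.ker f = LinearMap.ker (C.d (j + 1)) from LinearMap.ker_codRestrict _ _ _]
      exact ih (j + 1) fun l hl => h l (by omega)

theorem ProjRes.hasFPUpTo {M : Type v} [AddCommGroup M] [Module R M] (C : ProjRes R M) (i : ℕ)
    (h : ∀ l, l ≤ i → Module.Finite R (C.P l)) : HasFPUpTo R i (ULift.{u} M) := by
  have h0 := h 0 (Nat.zero_le _)
  have hs : Function.Surjective (ULift.moduleEquiv.{u}.symm.toLinearMap ∘ₗ C.aug) :=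
    ULift.moduleEquiv.symm.surjective.comp C.aug_surjective
  cases i with
  | zero => exact Module.Finite.of_surjective _ hs
  | succ i =>
    refine ⟨C.P 0, _, _, _, C.projective 0, h0, hs, ?_⟩
    rw [LinearEquiv.ker_comp]
    have h1 := h 1 (by omega)
    let f := (C.d 0).codRestrict (LinearMap.ker C.aug) (fun x => (C.exact_zero _).2 ⟨x, rfl⟩)
    have hf : Function.Surjective f := by
      rintro ⟨x, hx⟩
      obtain ⟨y, rfl⟩ := (C.exact_zero x).1 hx
      exact ⟨y, rfl⟩
    cases i with
    | zero => exact Module.Finite.of_surjective f hf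
    | succ i =>
      refine ⟨C.P 1, _, _, f, C.projective 1, h1, hf, ?_⟩
      rw [show LinearMap.ker f = LinearMap.ker (C.d 0) from LinearMap.ker_codRestrict _ _ _]
      exact C.hasFPUpTo_ker_d i 0 fun l hl => h l (by omega)

theorem isTypeFP_iff_hasFPUpTo {n : ℕ∞} {M : Type v} [AddCommGroup M] [Module R M] :
    IsTypeFP n R M ↔ ∀ i : ℕ, (i : ℕ∞) ≤ n → HasFPUpTo R i (ULift.{u} M) :=
  ⟨fun ⟨C, hC⟩ i hi => C.hasFPUpTo i fun l hl => hC l (le_trans (by exact_mod_cast hl) hi),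
    IsTypeFP.of_hasFPUpTo⟩

end Comparison

/-! ### The functor `M ↦ B ⊗ M` from `H`-modules to `B`-bimodules. -/

section GaloisTensor

variable {k : Type u} {H : Type v} {B : Type w} [Field k] [Ring H] [HopfAlgebra k H] [Ring B]
  [Algebra k B]

variable (k H) in
/-- The antipode as an algebra homomorphism from the opposite algebra. -/
noncomputable def HopfAlgebra.antipodeOfOp : Hᵐᵒᵖ →ₐ[k] H :=
  AlgHom.ofLinearMap (HopfAlgebra.antipode k ∘ₗ (opLinearEquiv k).symm.toLinearMap)
    (by simp) (fun x y => by simp [HopfAlgebra.antipode_mul_antidistrib])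

/-- The module `B ⊗ M` associated with an `H`-module `M`; it is a `B`-bimodule with
`b' (b ⊗ m) b'' = b' b b''₀ ⊗ S(b''₁) m`. -/
def RightComoduleAlgebra.Induced (_c : RightComoduleAlgebra k H B) (M : Type t) [AddCommGroup M]
    [Module k M] : Type (max w t) :=
  B ⊗[k] M

namespace RightComoduleAlgebra

variable (c : RightComoduleAlgebra k H B) (M : Type t) [AddCommGroup M] [Module k M]

noncomputable instance : AddCommGroup (c.Induced M) := inferInstanceAs (AddCommGroup (B ⊗[k] M))

variable [Module H M] [IsScalarTower k H M]

variable (k H B) in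
/-- The right action of `B ⊗ H` on `B ⊗ M` by `(b ⊗ m) (b' ⊗ h) = b b' ⊗ S(h) m`. -/
noncomputable def tensorRightAction : (B ⊗[k] H)ᵐᵒᵖ →ₐ[k] Module.End k (B ⊗[k] M) :=
  ((Module.endTensorEndAlgHom (R := k) (S := k) (A := k) (M := B) (N := M)).comp
    (Algebra.TensorProduct.map (Algebra.lsmul k k B : Bᵐᵒᵖ →ₐ[k] Module.End k B)
      ((Algebra.lsmul k k M : H →ₐ[k] Module.End k M).comp (HopfAlgebra.antipodeOfOp k H)))).comp
    (Algebra.TensorProduct.opAlgEquiv k k B H).symm.toAlgHom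

theorem tensorRightAction_tmul (b b' : B) (h : H) (m : M) :
    tensorRightAction k H B M (op (b' ⊗ₜ h)) (b ⊗ₜ m) =
      (b * b') ⊗ₜ (HopfAlgebra.antipode k h • m) := rfl

/-- The action of the enveloping algebra on `B ⊗ M`. -/
noncomputable def inducedAction : B ⊗[k] Bᵐᵒᵖ →ₐ[k] Module.End k (B ⊗[k] M) :=
  Algebra.TensorProduct.lift
    ((Module.endTensorEndAlgHom (R := k) (S := k) (A := k) (M := B) (N := M)).comp
      (Algebra.TensorProduct.includeLeft.comp (Algebra.lsmul k k B : B →ₐ[k] Module.End k B)))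
    ((tensorRightAction k H B M).comp (AlgHom.op c.ρ))
    -- Left multiplication touches only the factor `B`, so the two actions commute by associativity
    -- of `B`.
    (fun x y => by
      change _ * tensorRightAction k H B M (op (c.ρ y.unop)) =
        tensorRightAction k H B M (op (c.ρ y.unop)) * _
      generalize c.ρ y.unop = z
      induction z with
      | zero => simp
      | add z z' hz hz' => rw [op_add, map_add, mul_add, add_mul, hz, hz']
      | tmul b h =>
        ext b' m
        change (x * (b' * b)) ⊗ₜ[k] (HopfAlgebra.antipode k h • m) =
          (x * b' * b) ⊗ₜ[k] (HopfAlgebra.antipode k h • m)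
        rw [mul_assoc])

noncomputable instance : Module (B ⊗[k] Bᵐᵒᵖ) (c.Induced M) :=
  Module.compHom (B ⊗[k] M) (c.inducedAction M).toRingHom

variable {M}

variable {N : Type t'} [AddCommGroup N] [Module k N] [Module H N] [IsScalarTower k H N]

theorem lTensor_tensorRightAction (f : M →ₗ[H] N) (y : B ⊗[k] H) (x : B ⊗[k] M) :
    (f.restrictScalars k).lTensor B (tensorRightAction k H B M (op y) x) =
      tensorRightAction k H B N (op y) ((f.restrictScalars k).lTensor B x) := by
  induction y with
  | zero => simp
  | add y y' hy hy' => simp only [op_add, map_add, LinearMap.add_apply, hy, hy']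
  | tmul b h =>
    induction x with
    | zero => simp
    | add x x' hx hx' => simp only [map_add, hx, hx']
    | tmul b' m => simp [tensorRightAction_tmul]

/-- An additive map between modules over `B ⊗ Bᵒᵖ` is linear if it respects the action of pure
tensors. -/
def _root_.LinearMap.ofPureTensors {X Y : Type*} [AddCommGroup X] [AddCommGroup Y]
    [Module (B ⊗[k] Bᵐᵒᵖ) X] [Module (B ⊗[k] Bᵐᵒᵖ) Y] (f : X →+ Y)
    (hf : ∀ (b b' : B) (x : X), f ((b ⊗ₜ[k] op b') • x) = (b ⊗ₜ[k] op b') • f x) :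
    X →ₗ[B ⊗[k] Bᵐᵒᵖ] Y where
  toFun := f
  map_add' := map_add f
  map_smul' r x := by
    induction r with
    | zero =>
      exact (congrArg f (zero_smul (B ⊗[k] Bᵐᵒᵖ) x)).trans
        ((map_zero f).trans (zero_smul (B ⊗[k] Bᵐᵒᵖ) (f x)).symm)
    | add r s hr hs => simp only [add_smul, map_add, hr, hs]
    | tmul b b' => exact hf b b'.unop x

/-- Functoriality of `M ↦ B ⊗ M`. -/
noncomputable def inducedMap (f : M →ₗ[H] N) : c.Induced M →ₗ[B ⊗[k] Bᵐᵒᵖ] c.Induced N :=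
  LinearMap.ofPureTensors ((f.restrictScalars k).lTensor B).toAddMonoidHom (fun b b' x => by
    have h := LinearMap.congr_fun ((LinearMap.lTensor_comp_rTensor B (LinearMap.mulLeft k b)
      (f.restrictScalars k)).trans (LinearMap.rTensor_comp_lTensor B (LinearMap.mulLeft k b)
      (f.restrictScalars k)).symm) (tensorRightAction k H B M (op (c.ρ b')) x)
    exact h.trans (congrArg _ (lTensor_tensorRightAction f (c.ρ b') x)))

theorem inducedMap_comp {L : Type*} [AddCommGroup L] [Module k L] [Module H L]
    [IsScalarTower k H L] (g : N →ₗ[H] L) (f : M →ₗ[H] N) :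
    c.inducedMap (g ∘ₗ f) = c.inducedMap g ∘ₗ c.inducedMap f := by
  refine LinearMap.ext fun x => ?_
  exact LinearMap.congr_fun
    (LinearMap.lTensor_comp B (g.restrictScalars k) (f.restrictScalars k)) x

theorem inducedMap_id : c.inducedMap (LinearMap.id : M →ₗ[H] M) = LinearMap.id := by
  refine LinearMap.ext fun x => ?_
  exact LinearMap.congr_fun (LinearMap.lTensor_id B M) x

/-- Functoriality of `M ↦ B ⊗ M` for isomorphisms. -/
noncomputable def inducedEquiv (e : M ≃ₗ[H] N) : c.Induced M ≃ₗ[B ⊗[k] Bᵐᵒᵖ] c.Induced N :=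
  LinearEquiv.ofLinearMap (c.inducedMap e.toLinearMap) (c.inducedMap e.symm.toLinearMap)
    (by rw [← inducedMap_comp, LinearEquiv.comp_symm, inducedMap_id])
    (by rw [← inducedMap_comp, LinearEquiv.symm_comp, inducedMap_id])

theorem inducedMap_surjective (f : M →ₗ[H] N) (hf : Function.Surjective f) :
    Function.Surjective (c.inducedMap f) :=
  LinearMap.lTensor_surjective B (g := f.restrictScalars k) hf

theorem inducedMap_injective (f : M →ₗ[H] N) (hf : Function.Injective f) :
    Function.Injective (c.inducedMap f) :=
  Module.Flat.lTensor_preserves_injective_linearMap (M := B) (f.restrictScalars k) hf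

theorem inducedMap_exact {L : Type*} [AddCommGroup L] [Module k L] [Module H L]
    [IsScalarTower k H L] (f : M →ₗ[H] N) (g : N →ₗ[H] L) (h : Function.Exact f g) :
    Function.Exact (c.inducedMap f) (c.inducedMap g) :=
  Module.Flat.lTensor_exact (R := k) B (f := f.restrictScalars k) (g := g.restrictScalars k) h

/-- `M ↦ B ⊗ M` commutes with kernels. -/
noncomputable def inducedKer (f : M →ₗ[H] N) :
    c.Induced (LinearMap.ker f) ≃ₗ[B ⊗[k] Bᵐᵒᵖ] LinearMap.ker (c.inducedMap f) :=
  (LinearEquiv.ofInjective (c.inducedMap (LinearMap.ker f).subtype)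
    (c.inducedMap_injective _ Subtype.val_injective)).trans
    (LinearEquiv.ofEq _ _
      (c.inducedMap_exact _ f (LinearMap.exact_subtype_ker_map f)).linearMap_ker_eq.symm)

/-- For a Galois extension of the base field, `B ⊗ H` is free of rank one over the enveloping
algebra. -/
theorem exists_equiv_induced_self (hS : Function.Bijective (HopfAlgebra.antipode k (A := H)))
    (hc : c.IsGaloisOverBase) :
    Nonempty ((B ⊗[k] Bᵐᵒᵖ) ≃ₗ[B ⊗[k] Bᵐᵒᵖ] c.Induced H) := by
  let f : (B ⊗[k] Bᵐᵒᵖ) →ₗ[B ⊗[k] Bᵐᵒᵖ] c.Induced H :=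
    LinearMap.toSpanSingleton _ _ (show c.Induced H from (1 : B) ⊗ₜ[k] (1 : H))
  let e : B ⊗[k] Bᵐᵒᵖ ≃ₗ[k] B ⊗[k] B :=
    TensorProduct.congr (LinearEquiv.refl k B) (opLinearEquiv k).symm
  let s : H ≃ₗ[k] H := LinearEquiv.ofBijective (HopfAlgebra.antipode k) hS
  -- The orbit map of `1 ⊗ 1` is the canonical map twisted by the antipode.
  have key : ⇑f = TensorProduct.congr (LinearEquiv.refl k B) s ∘ c.canonicalMap ∘ e := by
    funext x
    induction x with
    | zero => simp; rfl
    | add x y hx hy =>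
      simp only [map_add, Function.comp_apply] at hx hy ⊢
      rw [hx, hy]
      rfl
    | tmul b b' =>
      change (LinearMap.mulLeft k b).rTensor H
          (tensorRightAction k H B H (op (c.ρ b'.unop)) (1 ⊗ₜ 1)) =
        TensorProduct.congr (LinearEquiv.refl k B) s ((b ⊗ₜ 1) * c.ρ b'.unop)
      generalize c.ρ b'.unop = y
      induction y with
      | zero => simp
      | add y z hy hz => simp only [op_add, map_add, LinearMap.add_apply, mul_add, hy, hz]
      | tmul a h => simp [tensorRightAction_tmul, s]
  refine ⟨LinearEquiv.ofBijective f ?_⟩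
  rw [key]
  exact (LinearEquiv.bijective _).comp (hc.canonicalMap_bijective.comp e.bijective)

end RightComoduleAlgebra

end GaloisTensor

/-! ### Transfer and descent of finiteness along `M ↦ B ⊗ M`. -/

section GaloisDescent

variable {k : Type u} {H : Type v} {B : Type w} [Field k] [Ring H] [HopfAlgebra k H] [Ring B]
  [Algebra k B]

namespace RightComoduleAlgebra

variable (c : RightComoduleAlgebra k H B)

/-- `M ↦ B ⊗ M` commutes with direct sums of copies of `H`. -/
theorem exists_equiv_induced_finsupp (ι : Type*) :
    Nonempty ((ι →₀ c.Induced H) ≃ₗ[B ⊗[k] Bᵐᵒᵖ] c.Induced (ι →₀ H)) := by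
  classical
  let f : (ι →₀ c.Induced H) →ₗ[B ⊗[k] Bᵐᵒᵖ] c.Induced (ι →₀ H) :=
    Finsupp.lsum ℕ fun i => c.inducedMap (Finsupp.lsingle i)
  refine ⟨LinearEquiv.ofBijective f ?_⟩
  have key : ⇑f = (TensorProduct.finsuppRight k k B H ι).symm := by
    funext x
    refine (LinearEquiv.eq_symm_apply (TensorProduct.finsuppRight k k B H ι)).2 ?_
    induction x using Finsupp.induction_linear with
    | zero => exact (congrArg _ (map_zero f)).trans (map_zero _)
    | add x y hx hy =>
      exact (congrArg _ (map_add f x y)).trans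
        ((map_add (TensorProduct.finsuppRight k k B H ι) _ _).trans (congrArg₂ (· + ·) hx hy))
    | single i x =>
      have hsum : f (Finsupp.single i x) = c.inducedMap (Finsupp.lsingle i) x := by simp [f]
      rw [hsum]
      clear hsum
      change TensorProduct.finsuppRight k k B H ι
        (((Finsupp.lsingle i : H →ₗ[H] ι →₀ H).restrictScalars k).lTensor B x) = _
      change B ⊗[k] H at x
      induction x with
      | zero => exact (map_zero _).trans (Finsupp.single_zero i).symm
      | add x y hx hy =>
        rw [map_add, map_add, hx, hy]
        exact (Finsupp.single_add i _ _).symm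
      | tmul b h =>
        exact (TensorProduct.finsuppRight_apply_tmul _ _).trans (Finsupp.sum_single_index (by simp))
  rw [key]
  exact LinearEquiv.bijective _

theorem exists_equiv_induced_free (hS : Function.Bijective (HopfAlgebra.antipode k (A := H)))
    (hc : c.IsGaloisOverBase) (ι : Type*) :
    Nonempty ((ι →₀ B ⊗[k] Bᵐᵒᵖ) ≃ₗ[B ⊗[k] Bᵐᵒᵖ] c.Induced (ι →₀ H)) := by
  obtain ⟨e⟩ := c.exists_equiv_induced_finsupp ι
  obtain ⟨e'⟩ := c.exists_equiv_induced_self hS hc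
  exact ⟨(Finsupp.mapRange.linearEquiv e').trans e⟩

variable (M : Type t) [AddCommGroup M] [Module k M] [Module H M] [IsScalarTower k H M]

/-- Functoriality carries a splitting of `M` off the free module `M →₀ H` to a splitting of `B ⊗ M`
off a free `Bᵉ`-module. -/
theorem projective_induced (hS : Function.Bijective (HopfAlgebra.antipode k (A := H)))
    (hc : c.IsGaloisOverBase) [Module.Projective H M] :
    Module.Projective (B ⊗[k] Bᵐᵒᵖ) (c.Induced M) := by
  obtain ⟨s, hs⟩ := (Module.projective_def'.1 (inferInstance : Module.Projective H M))
  obtain ⟨e⟩ := c.exists_equiv_induced_free hS hc M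
  have : Module.Projective (B ⊗[k] Bᵐᵒᵖ) (c.Induced (M →₀ H)) := Module.Projective.of_equiv e
  refine Module.Projective.of_split (c.inducedMap s)
    (c.inducedMap (Finsupp.linearCombination H id)) ?_
  rw [← inducedMap_comp, hs, inducedMap_id]

theorem finite_induced (hS : Function.Bijective (HopfAlgebra.antipode k (A := H)))
    (hc : c.IsGaloisOverBase) [Module.Finite H M] :
    Module.Finite (B ⊗[k] Bᵐᵒᵖ) (c.Induced M) := by
  obtain ⟨m, f, hf⟩ := Module.Finite.exists_fin' H M
  obtain ⟨e⟩ := c.exists_equiv_induced_free hS hc (Fin m)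
  have : Module.Finite (B ⊗[k] Bᵐᵒᵖ) (c.Induced (Fin m →₀ H)) := Module.Finite.equiv e
  exact Module.Finite.of_surjective
    (c.inducedMap (f ∘ₗ (Finsupp.linearEquivFunOnFinite H H (Fin m)).toLinearMap))
    (c.inducedMap_surjective _ (hf.comp (LinearEquiv.surjective _)))

theorem finite_of_finite_induced [Nontrivial B]
    [Module.Finite (B ⊗[k] Bᵐᵒᵖ) (c.Induced M)] : Module.Finite H M := by
  obtain ⟨s, hs⟩ := Module.Finite.fg_top (R := B ⊗[k] Bᵐᵒᵖ) (M := c.Induced M)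
  -- Finitely many generators of `B ⊗ M` involve only a finite-dimensional subspace of `M`. The
  -- `H`-submodule `N` that it generates satisfies `B ⊗ N = B ⊗ M`, hence `N = M` by faithful
  -- flatness.
  obtain ⟨N', hN', hsN'⟩ := TensorProduct.exists_finite_submodule_right_of_setFinite
    (R := k) (M := B) (N := M) (s : Set (c.Induced M)) s.finite_toSet
  obtain ⟨T, rfl⟩ := Module.Finite.iff_fg.1 hN'
  let N : Submodule H M := Submodule.span H (T : Set M)
  have hle : Submodule.span k (T : Set M) ≤ N.restrictScalars k :=
    Submodule.span_le.2 Submodule.subset_span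
  have hsurj : Function.Surjective (c.inducedMap N.subtype) := by
    rw [← LinearMap.range_eq_top, eq_top_iff, ← hs, Submodule.span_le]
    intro x hx
    obtain ⟨y, rfl⟩ := hsN' hx
    exact ⟨(Submodule.inclusion hle).lTensor B y,
      (LinearMap.lTensor_comp_apply B (N.subtype.restrictScalars k)
        (Submodule.inclusion hle) y).symm⟩
  have hN : Function.Surjective N.subtype :=
    (Module.FaithfullyFlat.lTensor_surjective_iff_surjective k B
      (N.subtype.restrictScalars k)).1 hsurj
  have : Module.Finite H N := Module.Finite.span_finset H T
  exact Module.Finite.of_surjective N.subtype hN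

end RightComoduleAlgebra

namespace HasFPUpTo

variable (c : RightComoduleAlgebra k H B)

theorem induced (hS : Function.Bijective (HopfAlgebra.antipode k (A := H)))
    (hc : c.IsGaloisOverBase) (n : ℕ) :
    ∀ {M : Type t} [AddCommGroup M] [Module k M] [Module H M] [IsScalarTower k H M],
      HasFPUpTo H n M → HasFPUpTo (B ⊗[k] Bᵐᵒᵖ) n (c.Induced M) := by
  induction n with
  | zero =>
    intro M _ _ _ _ h
    have : Module.Finite H M := h
    exact c.finite_induced M hS hc
  | succ n ih =>
    rintro M _ _ _ _ ⟨Q, _, _, f, hP, hF, hs, hk⟩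
    let _ : Module k Q := Module.compHom Q (algebraMap k H)
    have : IsScalarTower k H Q := IsScalarTower.of_algebraMap_smul fun _ _ => rfl
    exact ⟨c.Induced Q, _, _, c.inducedMap f, c.projective_induced Q hS hc,
      c.finite_induced Q hS hc, c.inducedMap_surjective f hs, (ih hk).congr (c.inducedKer f)⟩

/-- The cover is chosen over `H`, once `M` is known to be finitely generated. Schanuel's lemma over
`Bᵉ` then passes the hypothesis to the induced kernel, which is the kernel of the induced cover. -/
theorem of_induced (hS : Function.Bijective (HopfAlgebra.antipode k (A := H)))
    (hc : c.IsGaloisOverBase) [Nontrivial B] (n : ℕ) :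
    ∀ {M : Type (max v t)} [AddCommGroup M] [Module k M] [Module H M] [IsScalarTower k H M],
      HasFPUpTo (B ⊗[k] Bᵐᵒᵖ) n (c.Induced M) → HasFPUpTo H n M := by
  induction n with
  | zero =>
    intro M _ _ _ _ h
    have : Module.Finite (B ⊗[k] Bᵐᵒᵖ) (c.Induced M) := h
    exact c.finite_of_finite_induced M
  | succ n ih =>
    intro M _ _ _ _ h
    have := h.finite
    have : Module.Finite H M := c.finite_of_finite_induced M
    obtain ⟨Q, _, _, f, hP, hF, hs⟩ := HasFPUpTo.exists_finite_cover.{v, t} H M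
    let _ : Module k Q := Module.compHom Q (algebraMap k H)
    have : IsScalarTower k H Q := IsScalarTower.of_algebraMap_smul fun _ _ => rfl
    have := c.projective_induced Q hS hc
    have := c.finite_induced Q hS hc
    exact ⟨Q, _, _, f, hP, hF, hs,
      ih ((h.ker (c.inducedMap f) (c.inducedMap_surjective f hs)).congr (c.inducedKer f).symm)⟩

end HasFPUpTo

/-! ### The trivial module corresponds to the bimodule `B`. -/

section Trivial

instance : Module k (TrivialModule k H) := inferInstanceAs (Module k k)

instance : IsScalarTower k H (TrivialModule k H) where
  smul_assoc r h x := by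
    change Coalgebra.counit (R := k) (r • h) * (show k from x) =
      r * (Coalgebra.counit (R := k) h * (show k from x))
    rw [map_smul, smul_eq_mul, mul_assoc]

namespace RightComoduleAlgebra

variable (c : RightComoduleAlgebra k H B)

variable (k H B) in
/-- The isomorphism `B ⊗ k ≅ B`, where `k` is the trivial module. -/
noncomputable def tensorTrivial : B ⊗[k] TrivialModule k H ≃ₗ[k] B :=
  (TensorProduct.congr (LinearEquiv.refl k B)
    (show TrivialModule k H ≃ₗ[k] k from LinearEquiv.refl k k)).trans (TensorProduct.rid k B)

/-- Since `ε ∘ S = ε`, the antipode disappears on the trivial module. For `y = ρ(b')` the right-hand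
factor is `b'` by counitality. -/
theorem tensorTrivial_tensorRightAction (y : B ⊗[k] H) (x : B ⊗[k] TrivialModule k H) :
    tensorTrivial k H B (tensorRightAction k H B (TrivialModule k H) (op y) x) =
      tensorTrivial k H B x *
        TensorProduct.rid k B ((Coalgebra.counit (R := k) (A := H)).lTensor B y) := by
  induction y with
  | zero => simp
  | add y y' hy hy' => simp only [op_add, map_add, LinearMap.add_apply, mul_add, hy, hy']
  | tmul b h =>
    induction x with
    | zero => simp
    | add x x' hx hx' => simp only [map_add, add_mul, hx, hx']
    | tmul b' m =>
      change (Coalgebra.counit (R := k) (HopfAlgebra.antipode k h) * (show k from m)) • (b' * b) =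
        ((show k from m) • b') * (Coalgebra.counit (R := k) h • b)
      rw [HopfAlgebra.counit_antipode, smul_mul_smul_comm, mul_comm]

theorem tensorTrivial_rTensor_mulLeft (b : B) (z : B ⊗[k] TrivialModule k H) :
    tensorTrivial k H B ((LinearMap.mulLeft k b).rTensor (TrivialModule k H) z) =
      b * tensorTrivial k H B z := by
  induction z with
  | zero => simp
  | add z z' hz hz' => simp only [map_add, mul_add, hz, hz']
  | tmul a r => exact (mul_smul_comm (show k from r) b a).symm

theorem rid_counit_ρ (b : B) :
    TensorProduct.rid k B ((Coalgebra.counit (R := k) (A := H)).lTensor B (c.ρ b)) = b :=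
  LinearMap.congr_fun c.counit b

/-- The bimodule associated with the trivial module is `B`. -/
noncomputable def inducedTrivial :
    letI : Module (B ⊗[k] Bᵐᵒᵖ) B := TensorProduct.Algebra.module
    c.Induced (TrivialModule k H) ≃ₗ[B ⊗[k] Bᵐᵒᵖ] B :=
  letI : Module (B ⊗[k] Bᵐᵒᵖ) B := TensorProduct.Algebra.module
  LinearEquiv.ofBijective
    (LinearMap.ofPureTensors (X := c.Induced (TrivialModule k H))
      (tensorTrivial k H B).toLinearMap.toAddMonoidHom
      (fun b b' (x : B ⊗[k] TrivialModule k H) => by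
        change tensorTrivial k H B ((LinearMap.mulLeft k b).rTensor (TrivialModule k H)
          (tensorRightAction k H B (TrivialModule k H) (op (c.ρ b')) x)) =
            b * (tensorTrivial k H B x * b')
        rw [tensorTrivial_rTensor_mulLeft, tensorTrivial_tensorRightAction, rid_counit_ρ]))
    (tensorTrivial k H B).bijective

theorem IsGaloisOverBase.nontrivial {c : RightComoduleAlgebra k H B} (hc : c.IsGaloisOverBase) :
    Nontrivial B :=
  have : Nontrivial c.coinvariants := hc.coinvariants_eq.1.nontrivial
  (Subtype.val_injective (p := fun b => b ∈ c.coinvariants)).nontrivial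

end RightComoduleAlgebra

end Trivial

end GaloisDescent

theorem mainTheorem4 {k : Type u} {H : Type v} {B : Type w} [Field k] [Ring H] [HopfAlgebra k H]
    (hS : Function.Bijective (HopfAlgebra.antipode k (A := H)))
    [Ring B] [Algebra k B] (c : RightComoduleAlgebra k H B) (hc : c.IsGaloisOverBase) (n : ℕ∞) :
    HopfAlgebra.IsTypeFP n k H ↔ IsBimoduleTypeFP n k B := by
  have := hc.nontrivial
  let _ : Module (B ⊗[k] Bᵐᵒᵖ) B := TensorProduct.Algebra.module
  -- The lifts match the universes of the syzygy criterion over `H` and over `Bᵉ`; `congr_universe`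
  -- bridges the remaining difference.
  have e : c.Induced (ULift.{v} (TrivialModule k H)) ≃ₗ[B ⊗[k] Bᵐᵒᵖ] ULift.{w} B :=
    (c.inducedEquiv ULift.moduleEquiv).trans (c.inducedTrivial.trans ULift.moduleEquiv.symm)
  unfold HopfAlgebra.IsTypeFP IsBimoduleTypeFP
  rw [isTypeFP_iff_hasFPUpTo, isTypeFP_iff_hasFPUpTo]
  refine forall₂_congr fun i _ => ⟨fun h => ?_, fun h => ?_⟩
  · exact HasFPUpTo.congr_universe.{w, max u v w, w} e (h.induced c hS hc i)
  · exact HasFPUpTo.of_induced.{u, v, w, u} c hS hc i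
      (HasFPUpTo.congr_universe.{w, w, max u v w} e.symm h)
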